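/- Let $X$ be a topological space. The $\theta$-closure of $A\subseteq X$ is $cl_\theta(A)=\{x\in X : \overline{U}\cap A\neq\emptyset \text{ for every open } U\ni x\}$, and for $n\in\omega$ the $n$-$\theta$-closure $cl_\theta^n(A)$ is the result of applying $cl_\theta$ to $A$ $n$ times. $X$ is $\theta^n$-Urysohn if any two distinct points $x,y\in X$ have open neighborhoods $U\ni x$, $V\ni y$ with $cl_\theta^n(U)\cap cl_\theta^n(V)=\emptyset$. A family $\mathcal V$ of open subsets of $X$ is $\theta^n$-Urysohn cellular if $cl_\theta^n(V_1)\cap cl_\theta^n(V_2)=\emptyset$ for all distinct $V_1,V_2\in\mathcal V$, and $\theta^n\text{-}Uc(X)=\sup\{|\mathcal V| : \mathcal V \text{ is } \theta^n\text{-Urysohn cellular}\}$. A local $\pi$-base at $x$ is a family of nonempty open sets such that every open neighborhood of $x$ contains a member of it; $\pi_\chi(x,X)$ is the least cardinality of a local $\pi$-base at $x$, and $\pi_\chi(X)=\sup_{x\in X}\pi_\chi(x,X)$. $X$ is homogeneous if for all $x,y\in X$ there is a homeomorphism $h:X\to X$ with $h(x)=y$, and power homogeneous if $X^\kappa$ (with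 the product topology) is homogeneous for some cardinal $\kappa\geq 1$. **Theorem.** Let $n\in\omega$. If $X$ is power homogeneous and $\theta^n$-Urysohn, then $$|X|\leq 2^{\theta^n\text{-}Uc(X)\cdot\pi_\chi(X)}.$$ -/

import Mathlib

open Cardinal

universe u v

/-- The `θ`-closure of `A`: the points all of whose open neighborhoods have a closure meeting `A`. -/
def thetaClosure {X : Type*} [TopologicalSpace X] (A : Set X) : Set X :=
  {x | ∀ U : Set X, IsOpen U → x ∈ U → (closure U ∩ A).Nonempty}

/-- The `n`-`θ`-closure: the `n`-fold iterate of the `θ`-closure. -/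
def nThetaClosure {X : Type*} [TopologicalSpace X] (n : ℕ) (A : Set X) : Set X :=
  thetaClosure^[n] A

/-- `X` is `θⁿ`-Urysohn: distinct points have open neighborhoods with disjoint
`n`-`θ`-closures. -/
def IsThetaUrysohn (n : ℕ) (X : Type*) [TopologicalSpace X] : Prop :=
  ∀ x y : X, x ≠ y → ∃ U V : Set X, IsOpen U ∧ IsOpen V ∧ x ∈ U ∧ y ∈ V ∧
    nThetaClosure n U ∩ nThetaClosure n V = ∅

/-- A family of open sets is `θⁿ`-Urysohn cellular if any two distinct members have disjoint
`n`-`θ`-closures. -/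
def IsThetaUrysohnCellular {X : Type*} [TopologicalSpace X] (n : ℕ) (𝒱 : Set (Set X)) : Prop :=
  (∀ V ∈ 𝒱, IsOpen V) ∧
    ∀ V ∈ 𝒱, ∀ W ∈ 𝒱, V ≠ W → nThetaClosure n V ∩ nThetaClosure n W = ∅

/-- The `θⁿ`-Urysohn cellularity of `X`. -/
noncomputable def thetaUrysohnCellularity (n : ℕ) (X : Type*) [TopologicalSpace X] : Cardinal :=
  ⨆ 𝒱 : {𝒱 : Set (Set X) // IsThetaUrysohnCellular n 𝒱}, #𝒱.1

/-- A local `π`-base at `x`: a family of nonempty open sets such that every open neighborhood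
of `x` contains a member of the family. -/
def IsLocalPiBase {X : Type*} [TopologicalSpace X] (x : X) (ℬ : Set (Set X)) : Prop :=
  (∀ B ∈ ℬ, IsOpen B ∧ B.Nonempty) ∧ ∀ U : Set X, IsOpen U → x ∈ U → ∃ B ∈ ℬ, B ⊆ U

/-- The `π`-character of the point `x`. -/
noncomputable def piCharacterAt {X : Type*} [TopologicalSpace X] (x : X) : Cardinal :=
  sInf {c | ∃ ℬ : Set (Set X), IsLocalPiBase x ℬ ∧ #ℬ = c}

/-- The `π`-character of the space `X`. -/
noncomputable def piCharacter (X : Type*) [TopologicalSpace X] : Cardinal :=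
  ⨆ x : X, piCharacterAt x

/-- `X` is homogeneous: any point is carried to any other by an autohomeomorphism. -/
def IsHomogeneousSpace (X : Type*) [TopologicalSpace X] : Prop :=
  ∀ x y : X, ∃ h : X ≃ₜ X, h x = y

/-- `X` is power homogeneous: some nonempty power of `X`, with the product topology, is
homogeneous. (The empty power is a point, which is homogeneous for every `X`.) -/
def IsPowerHomogeneous (X : Type u) [TopologicalSpace X] : Prop :=
  ∃ ι : Type v, Nonempty ι ∧ IsHomogeneousSpace (ι → X)

/-!
Let `κ` be an infinite cardinal bounding the `θⁿ`-Urysohn cellularity and the `π`-character of `X`,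
and let `K` be a type of cardinality `κ`. It suffices to attach to each point `x` a family `G x l`
of nonempty open sets, indexed by a set of `κ` labels `l` common to all points, such that for
`x ≠ y` some label `l` makes the `n`-`θ`-closures of `G x l` and `G y l` disjoint. For then, if
`|X| > 2 ^ κ`, the Erdős–Rado relation `(2 ^ κ)⁺ → (κ⁺)²_κ`
(`exists_large_pairwise_of_two_power_lt`) yields one label `l` and more than `κ` points `x` whose
sets `G x l` form a `θⁿ`-Urysohn cellular family.

In a homogeneous space the labels are the members of a local `π`-base at a point `p`, carried
to `x` by a homeomorphism. When only a power `I → X` is homogeneous, a homeomorphism taking the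
constant point `p` to the constant point `x`, followed by a coordinate projection, is a continuous
open map `φ : (I → X) → X` with value `x` at the constant point `p`. Basic open sets near that
point have supports anywhere in `I`, so there are too many of them. The remedy
(`exists_labelled_open_sets`) is to restrict to boxes supported in a set `A` of at most `κ`
coordinates, coded by `K`, and to refine each such box twice. If `U` is an open set containing
`x`, then `φ ⁻¹' U` contains an intersection `B ∩ Q`, with `B` a box supported in `A` and `Q` an
open set constraining only coordinates outside `A`, and `Q` contains all points that agree with
`p` outside `A`. For an open `D ⊆ B` containing such a point `z`, the open set `φ '' (D ∩ Q)`
contains some member `b` of a fixed local `π`-base at `φ z`, and then `D ∩ φ ⁻¹' b` is a nonempty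
open subset of `D` mapped into `U`. Hence the constraints outside `A` need not be known in order
to index the refinements by `K`. If `G s i j` is the image of the second refinement, with index
`j`, of the first refinement, with index `i`, of the box coded by `s`, then some `i` gives
`G s i j ⊆ U` for all `j`, while for every `i` some `j` gives `G s i j ⊆ U`. For two points
`x ≠ y`, choose `i` for the sake of `x` and then `j` for the sake of `y`: the same label
`(s, i, j)` serves both.
-/

universe w

/-! ### The Erdős–Rado relation -/

/-- The Erdős–Rado relation `(2 ^ κ)⁺ → (κ⁺)²_κ`: if the pairs of distinct points of a set of more
than `2 ^ κ` points are covered by `κ` symmetric relations, then one of these relations has a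
clique of more than `κ` points. -/
theorem exists_large_pairwise_of_two_power_lt {X K : Type u} [Infinite K] (R : K → X → X → Prop)
    (hsymm : ∀ c x y, R c x y → R c y x) (hR : ∀ x y, x ≠ y → ∃ c, R c x y)
    (hX : 2 ^ #K < #X) : ∃ (c : K) (C : Set X), C.Pairwise (R c) ∧ #K < #C := by
  classical
  by_contra! hC
  have hK : ℵ₀ ≤ #K := aleph0_le_mk K
  have : Nonempty X := mk_ne_zero_iff.1 (ne_bot_of_gt hX)
  -- The range of `e` has at most `2 ^ κ` points, and every configuration over at most `κ` of them
  -- which is realized in `X` is realized in the range.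
  let Φ : (a : Set K × (K → K)) → (a.1 → X) → X := fun a f =>
    if h : ∃ x, ∀ k : a.1, x ≠ f k ∧ R (a.2 k) (f k) x then h.choose else Classical.arbitrary X
  let e : WType (fun a : Set K × (K → K) => a.1) → X := WType.elim X fun p => Φ p.1 p.2
  have hM : #(Set.range e) ≤ 2 ^ #K := by
    refine mk_range_le.trans (WType.cardinalMk_le_of_le ?_)
    calc (sum fun a : Set K × (K → K) => ((2 : Cardinal.{u}) ^ #K) ^ #a.1)
        ≤ sum fun _ : Set K × (K → K) => (2 : Cardinal.{u}) ^ #K := by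
          refine sum_le_sum _ _ fun a => ?_
          rw [← power_mul]
          exact power_le_power_left two_ne_zero
            ((mul_le_mul_right (mk_set_le a.1) _).trans (mul_eq_self hK).le)
      _ = 2 ^ #K := by
          have h2 : ℵ₀ ≤ 2 ^ #K := hK.trans (cantor _).le
          simp only [sum_const, lift_id, mk_prod, mk_set, ← power_def, power_self_eq hK]
          rw [mul_eq_self h2, mul_eq_self h2]
  obtain ⟨y, hy⟩ : ∃ y, y ∉ Set.range e := by
    by_contra! h
    rw [Set.eq_univ_of_forall h, mk_univ] at hM
    exact hM.not_gt hX
  -- For each `c`, a maximal `R c`-clique `C c` among the points of the range that are `R c`-related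
  -- to `y`.
  have hmax : ∀ c, ∃ C, Maximal
      (fun C : Set X => C ⊆ {a | a ∈ Set.range e ∧ R c a y} ∧ C.Pairwise (R c)) C := by
    intro c
    refine zorn_subset {C : Set X | C ⊆ {a | a ∈ Set.range e ∧ R c a y} ∧ C.Pairwise (R c)} ?_
    intro S hS hchain
    refine ⟨⋃₀ S, ⟨Set.sUnion_subset fun s hs => (hS hs).1, ?_⟩,
      fun s hs => Set.subset_sUnion_of_mem hs⟩
    exact (Set.pairwise_sUnion hchain.directedOn).2 fun s hs => (hS hs).2
  choose C hCmax using hmax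
  have hcard : #(Σ c, C c) ≤ #K := by
    rw [mk_sigma]
    refine (sum_le_sum _ (fun _ => #K) fun c => hC c _ (hCmax c).prop.2).trans ?_
    simp [mul_eq_self hK]
  obtain ⟨j⟩ := hcard
  let inv : Set.range j → Σ c, C c := fun k => k.2.choose
  have hinv : ∀ p, inv ⟨j p, p, rfl⟩ = p := fun p =>
    j.injective (Exists.choose_spec (⟨p, rfl⟩ : ∃ q, j q = j p))
  have hlift : ∀ k : Set.range j, ∃ w, e w = (inv k).2 := fun k =>
    ((hCmax (inv k).1).prop.1 (inv k).2.2).1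
  choose w hw using hlift
  let t : K → K := fun k => if h : k ∈ Set.range j then (inv ⟨k, h⟩).1 else k
  have ht : ∀ k : Set.range j, t k = (inv k).1 := fun k => dif_pos k.2
  -- A point `x` of the range with the same relations to the cliques as `y`. It is `R c`-related to
  -- `y` for some `c`, and then it extends the maximal clique `C c`.
  let x := e (WType.mk (Set.range j, t) w)
  have hex : ∃ x, ∀ k : Set.range j, x ≠ e (w k) ∧ R (t k) (e (w k)) x := by
    refine ⟨y, fun k => ⟨fun h => hy ⟨_, h.symm⟩, ?_⟩⟩
    rw [hw, ht]
    exact ((hCmax (inv k).1).prop.1 (inv k).2.2).2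
  have hx : ∀ k : Set.range j, x ≠ e (w k) ∧ R (t k) (e (w k)) x := by
    have : x = hex.choose := dif_pos hex
    rw [this]
    exact hex.choose_spec
  have hxC : ∀ c, ∀ a ∈ C c, x ≠ a ∧ R c a x := by
    intro c a ha
    have := hx ⟨j ⟨c, a, ha⟩, _, rfl⟩
    rw [hw, ht, hinv] at this
    exact this
  have hxM : x ∈ Set.range e := ⟨_, rfl⟩
  obtain ⟨c, hc⟩ := hR x y fun h => hy (h ▸ hxM)
  have hins : x ∈ C c := (hCmax c).le_of_ge
    (y := insert x (C c)) ⟨Set.insert_subset ⟨hxM, hc⟩ (hCmax c).prop.1,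
      (hCmax c).prop.2.insert fun a ha _ =>
        ⟨hsymm _ _ _ (hxC c a ha).2, (hxC c a ha).2⟩⟩ (Set.subset_insert _ _)
      (Set.mem_insert _ _)
  exact (hxC c x hins).1 rfl

/-! ### Small sets of coordinates -/

theorem nonempty_iUnion_embedding {K : Type u} {I : Type v} {ι : Type w} [Infinite K]
    (hι : Nonempty (ι ↪ K)) (f : ι → Set I) (hf : ∀ i, Nonempty (f i ↪ K)) :
    Nonempty (↥(⋃ i, f i) ↪ K) := by
  obtain ⟨g⟩ := hι
  have e : ∀ i, f i ↪ K := fun i => (hf i).some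
  obtain ⟨p⟩ : Nonempty (K × K ≃ K) := Cardinal.eq.1 (mul_eq_self (aleph0_le_mk K))
  choose i hi using fun x : ↥(⋃ i, f i) => Set.mem_iUnion.1 x.2
  refine ⟨⟨fun x => p (g (i x), e (i x) ⟨x, hi x⟩), fun x y hxy => ?_⟩⟩
  obtain ⟨h₁, h₂⟩ := Prod.ext_iff.1 (p.injective hxy)
  have h := g.injective h₁
  dsimp only at h₂
  have key : ∀ j k (hj : (x : I) ∈ f j) (hk : (y : I) ∈ f k), j = k →
      e j ⟨x, hj⟩ = e k ⟨y, hk⟩ → x = y := by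
    rintro j _ hj hk rfl h
    exact Subtype.ext (congrArg (fun u : f j => (u : I)) ((e j).injective h))
  exact key _ _ _ _ h h₂

theorem mk_withZero_of_infinite (K : Type u) [Infinite K] : #(WithZero K) = #K := by
  have : #(WithZero K) = #K + 1 := mk_option
  rw [this, add_one_of_aleph0_le (aleph0_le_mk K)]

/-- Given a finite set of coordinates `F σ i` for each finitely supported `σ` and each `i : K`,
there is a set `A` of at most `#K` coordinates that contains `F σ i` whenever it contains the
support of `σ`. -/
theorem exists_closed_set_of_finset_valued {I : Type v} {K : Type u} [Infinite K] [Nonempty I]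
    (F : (I →₀ WithZero K) → K → Finset I) :
    ∃ A : Set I, Nonempty (A ↪ K) ∧
      ∀ σ : I →₀ WithZero K, ↑σ.support ⊆ A → ∀ i, ↑(F σ i) ⊆ A := by
  classical
  have : Infinite (WithZero K) := inferInstanceAs (Infinite (Option K))
  let step : Set I → Set I := fun A =>
    A ∪ ⋃ p : {σ : I →₀ WithZero K // ↑σ.support ⊆ A} × K, ↑(F p.1.1 p.2)
  obtain ⟨nat⟩ : Nonempty (ℕ ↪ K) := ⟨Infinite.natEmbedding K⟩
  obtain ⟨prod⟩ : Nonempty (K × K ≃ K) := Cardinal.eq.1 (mul_eq_self (aleph0_le_mk K))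
  have hfin : ∀ s : Finset I, Nonempty ((s : Set I) ↪ K) := fun s =>
    ⟨((s.equivFin.toEmbedding.trans Fin.valEmbedding).trans nat)⟩
  have hstep : ∀ A : Set I, A.Nonempty → Nonempty (A ↪ K) → Nonempty (step A ↪ K) := by
    intro A hA hAK
    have : Nonempty A := hA.to_subtype
    obtain ⟨code⟩ : Nonempty ({σ : I →₀ WithZero K // ↑σ.support ⊆ A} ↪ K) := by
      have hinj : Function.Injective fun σ : {σ : I →₀ WithZero K // ↑σ.support ⊆ A} =>
          Finsupp.subtypeDomain (· ∈ A) σ.1 := by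
        intro σ τ h
        ext1
        ext1 a
        by_cases ha : a ∈ A
        · exact DFunLike.congr_fun h ⟨a, ha⟩
        · rw [Finsupp.notMem_support_iff.1 fun h => ha (σ.2 h),
            Finsupp.notMem_support_iff.1 fun h => ha (τ.2 h)]
      obtain ⟨f⟩ : Nonempty ((A →₀ WithZero K) ↪ K) := by
        rw [← lift_mk_le', mk_finsupp_lift_of_infinite', mk_withZero_of_infinite, lift_max]
        rw [← lift_mk_le'] at hAK
        rw [lift_umax.{u, v}, lift_id'.{u, v}, lift_id'.{u, v}]
        exact max_le hAK le_rfl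
      exact ⟨(⟨_, hinj⟩ : _ ↪ _).trans f⟩
    have hU := nonempty_iUnion_embedding (K := K)
      ⟨(code.prodMap (Function.Embedding.refl K)).trans prod.toEmbedding⟩
      (fun p : {σ : I →₀ WithZero K // ↑σ.support ⊆ A} × K => (↑(F p.1.1 p.2) : Set I))
      fun p => hfin _
    have h2 := nonempty_iUnion_embedding (K := K) (ι := Bool)
      ⟨(Equiv.boolEquivPUnitSumPUnit.{0, 0}.toEmbedding.trans (Function.Embedding.trans
        ⟨fun x => x.elim (fun _ => 0) fun _ => 1, by decide⟩ nat))⟩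
      (fun b => bif b then A else ⋃ p : {σ : I →₀ WithZero K // ↑σ.support ⊆ A} × K,
        (↑(F p.1.1 p.2) : Set I)) (Bool.rec hU hAK)
    rwa [← Set.union_eq_iUnion] at h2
  obtain ⟨a⟩ := ‹Nonempty I›
  let A : ℕ → Set I := fun n => step^[n] {a}
  have hsucc : ∀ n, A (n + 1) = step (A n) := fun n => Function.iterate_succ_apply' _ _ _
  have hmono : Monotone A := monotone_nat_of_le_succ fun n => by
    rw [hsucc]; exact Set.subset_union_left
  have hA : ∀ n, Nonempty (A n ↪ K) := by
    intro n
    induction n with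
    | zero => simpa [A] using hfin {a}
    | succ n ih =>
      rw [hsucc]
      exact hstep _ ⟨a, hmono (Nat.zero_le n) rfl⟩ ih
  refine ⟨⋃ n, A n, nonempty_iUnion_embedding ⟨nat⟩ A hA, fun σ hσ i => ?_⟩
  obtain ⟨n, hn⟩ : ∃ n, (↑σ.support : Set I) ⊆ A n :=
    hmono.directed_le.exists_mem_subset_of_finset_subset_biUnion hσ
  refine Set.Subset.trans ?_ (Set.subset_iUnion A (n + 1))
  rw [hsucc]
  exact (Set.subset_iUnion (fun p : {σ : I →₀ WithZero K // ↑σ.support ⊆ A n} × K =>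
    (↑(F p.1.1 p.2) : Set I)) (⟨σ, hn⟩, i)).trans Set.subset_union_right

/-! ### Labelled open sets at a point -/

/-- The open box in a power of `X` with side `b (σ a)` in direction `a`. The value `0` stands for
"no constraint": it is used with `b 0 = univ`, which makes the box depend only on the finitely many
coordinates in the support of `σ`. -/
def finsuppBox {I : Type v} {L : Type w} {X : Type u} [Zero L] (b : L → Set X) (σ : I →₀ L) :
    Set (I → X) :=
  {z | ∀ a, z a ∈ b (σ a)}

theorem isOpen_finsuppBox {I : Type v} {L : Type w} {X : Type u} [Zero L] [TopologicalSpace X]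
    {b : L → Set X} (hb : ∀ l, IsOpen (b l)) (h0 : b 0 = Set.univ) (σ : I →₀ L) :
    IsOpen (finsuppBox b σ) := by
  have : finsuppBox b σ = (σ.support : Set I).pi fun a => b (σ a) := by
    ext z
    refine ⟨fun h a _ => h a, fun h a => ?_⟩
    by_cases ha : a ∈ σ.support
    · exact h a ha
    · rw [Finsupp.notMem_support_iff.1 ha, h0]; trivial
  rw [this]
  exact isOpen_set_pi σ.support.finite_toSet fun a _ => hb _

/-- The points that agree with a constant point off a finite set are dense in a power. -/
theorem exists_mem_eq_off_finset {I : Type v} {X : Type u} [TopologicalSpace X] (p : X)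
    {D : Set (I → X)} (hD : IsOpen D) (hne : D.Nonempty) :
    ∃ z ∈ D, ∃ F : Finset I, ∀ a ∉ F, z a = p := by
  classical
  obtain ⟨y, hy⟩ := hne
  obtain ⟨F, N, hN, hsub⟩ := isOpen_pi_iff.1 hD y hy
  exact ⟨fun a => if a ∈ F then y a else p,
    hsub fun a ha => by simpa [Finset.mem_coe.1 ha] using (hN a ha).2, F,
    fun a ha => if_neg ha⟩

/-- The refinement step: if an open set `D` meets the open set `Q` at `z` and `φ` maps `D ∩ Q` into
`U`, then a member of the local `π`-base at `φ z` cuts `D` down to a nonempty set mapped into `U`.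
The index is all that depends on `Q`. -/
theorem exists_index_image_subset {Y X K : Type*} [TopologicalSpace Y] [TopologicalSpace X]
    {φ : Y → X} (hφ : IsOpenMap φ) {b : X → K → Set X}
    (hbne : ∀ r i, (b r i).Nonempty)
    (hb : ∀ r U, IsOpen U → r ∈ U → ∃ i, b r i ⊆ U)
    {D Q : Set Y} (hD : IsOpen D) (hQ : IsOpen Q) {z : Y} (hz : z ∈ D ∩ Q) {U : Set X}
    (hU : D ∩ Q ⊆ φ ⁻¹' U) :
    ∃ i, (D ∩ φ ⁻¹' b (φ z) i).Nonempty ∧ φ '' (D ∩ φ ⁻¹' b (φ z) i) ⊆ U := by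
  obtain ⟨i, hi⟩ := hb (φ z) _ (hφ _ (hD.inter hQ)) (Set.mem_image_of_mem φ hz)
  refine ⟨i, ?_, ?_⟩
  · obtain ⟨u, hu⟩ := hbne (φ z) i
    obtain ⟨y, hy, rfl⟩ := hi hu
    exact ⟨y, hy.1, hu⟩
  · rintro _ ⟨y, hy, rfl⟩
    obtain ⟨y', hy', h⟩ := hi hy.2
    rw [← h]
    exact hU hy'

open Classical in
/-- The intersection of `D` with `E`, or `D` itself if the intersection is empty; so it is nonempty
as soon as `D` is. -/
noncomputable def refineOpen {Y : Type*} (D E : Set Y) : Set Y :=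
  if (D ∩ E).Nonempty then D ∩ E else D

theorem refineOpen_subset {Y : Type*} (D E : Set Y) : refineOpen D E ⊆ D := by
  unfold refineOpen; split_ifs
  exacts [Set.inter_subset_left, subset_rfl]

theorem refineOpen_of_nonempty {Y : Type*} {D E : Set Y} (h : (D ∩ E).Nonempty) :
    refineOpen D E = D ∩ E :=
  if_pos h

theorem refineOpen_nonempty {Y : Type*} {D : Set Y} (hD : D.Nonempty) (E : Set Y) :
    (refineOpen D E).Nonempty := by
  unfold refineOpen; split_ifs with h
  exacts [h, hD]

theorem isOpen_refineOpen {Y : Type*} [TopologicalSpace Y] {D E : Set Y} (hD : IsOpen D)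
    (hE : IsOpen E) : IsOpen (refineOpen D E) := by
  unfold refineOpen; split_ifs
  exacts [hD.inter hE, hD]

/-- A continuous open map `φ` from a power of `X` to `X` provides nonempty open sets
`G s i j`, with labels from a set that depends neither on the
power nor on `φ`. For an open `U` containing the value of `φ` at the constant point `p` and all `s` subject to finitely many neighbourhood
conditions at `p`, the first index `i` can be chosen so that `G s i j ⊆ U` whatever `j` is, and the
second index `j` can be chosen so that `G s i j ⊆ U` whatever `i` is. -/
theorem exists_labelled_open_sets {I : Type v} {X : Type u} {K : Type u} [TopologicalSpace X]
    [Infinite K] [Nonempty I]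
    {φ : (I → X) → X} (hcont : Continuous φ) (hopen : IsOpenMap φ) (p : X)
    {b : X → K → Set X} (hbo : ∀ r i, IsOpen (b r i)) (hbne : ∀ r i, (b r i).Nonempty)
    (hb : ∀ r U, IsOpen U → r ∈ U → ∃ i, b r i ⊆ U)
    {b₀ : WithZero K → Set X} (hb₀o : ∀ l, IsOpen (b₀ l)) (hb₀ne : ∀ l, (b₀ l).Nonempty)
    (hb₀ : b₀ 0 = Set.univ) :
    ∃ G : (K →₀ WithZero K) → K → K → Set X, (∀ s i j, IsOpen (G s i j) ∧ (G s i j).Nonempty) ∧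
      ∀ U, IsOpen U → φ (fun _ => p) ∈ U →
        ∃ (T : Finset K) (W : K → Set X), (∀ k, IsOpen (W k) ∧ p ∈ W k) ∧
          (∀ k ∉ T, W k = Set.univ) ∧
          ∀ s : K →₀ WithZero K, (∀ k, b₀ (s k) ⊆ W k) →
            (∃ i, ∀ j, G s i j ⊆ U) ∧ ∀ i, ∃ j, G s i j ⊆ U := by
  classical
  -- The centre of the box of `σ`, equal to `p` off the support of `σ`.
  let q : (I →₀ WithZero K) → I → X := fun σ a => if σ a = 0 then p else (hb₀ne (σ a)).some
  have hq : ∀ σ, q σ ∈ finsuppBox b₀ σ := by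
    intro σ a
    by_cases h : σ a = 0
    · rw [h, hb₀]; trivial
    · simpa [q, h] using (hb₀ne (σ a)).some_mem
  have hBo := fun σ : I →₀ WithZero K => isOpen_finsuppBox hb₀o hb₀ σ
  let D₁ : (I →₀ WithZero K) → K → Set (I → X) := fun σ i =>
    refineOpen (finsuppBox b₀ σ) (φ ⁻¹' b (φ (q σ)) i)
  have hD₁o : ∀ σ i, IsOpen (D₁ σ i) := fun σ i =>
    isOpen_refineOpen (hBo σ) ((hbo _ _).preimage hcont)
  choose q₁ hq₁ F hF using fun σ i =>
    exists_mem_eq_off_finset p (hD₁o σ i) (refineOpen_nonempty ⟨_, hq σ⟩ _)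
  let D₂ : (I →₀ WithZero K) → K → K → Set (I → X) := fun σ i j =>
    refineOpen (D₁ σ i) (φ ⁻¹' b (φ (q₁ σ i)) j)
  obtain ⟨A, ⟨c⟩, hA⟩ := exists_closed_set_of_finset_valued F
  -- The finitely supported function on `I` that `s` encodes through the injection `c : A ↪ K`.
  let code : (K →₀ WithZero K) → (I →₀ WithZero K) := fun s =>
    (s.comapDomain c c.injective.injOn).extendDomain
  have hcode : ∀ s (a : A), code s a = s (c a) := fun s a => by
    simp [code]
  have hsupp : ∀ s, ↑(code s).support ⊆ A := fun s => Finsupp.support_extendDomain_subset _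
  refine ⟨fun s i j => φ '' D₂ (code s) i j, fun s i j => ⟨hopen _ ?_, ?_⟩, fun U hU hpU => ?_⟩
  · exact isOpen_refineOpen (hD₁o _ _) ((hbo _ _).preimage hcont)
  · exact (refineOpen_nonempty (refineOpen_nonempty ⟨_, hq _⟩ _) _).image φ
  -- A basic neighbourhood of the constant point; its sides in the directions from `A` are
  -- transported to `K` by `c`, and those outside `A` make up `Q` below.
  obtain ⟨S, N, hN, hSN⟩ := isOpen_pi_iff.1 (hU.preimage hcont) _ hpU
  refine ⟨(S.subtype (· ∈ A)).image c, fun k => ⋂ a ∈ S.subtype (· ∈ A), {u | c a = k → u ∈ N a},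
    fun k => ⟨isOpen_biInter_finset fun a ha => ?_, ?_⟩, fun k hk => ?_, fun s hs => ?_⟩
  · by_cases h : c a = k
    · simpa [h] using (hN a (by simpa using ha)).1
    · simp [h]
  · simp only [Set.mem_iInter]
    exact fun a ha _ => (hN a (by simpa using ha)).2
  · refine Set.eq_univ_of_forall fun u => ?_
    simp only [Set.mem_iInter]
    exact fun a ha h => (hk (Finset.mem_image.2 ⟨a, ha, h⟩)).elim
  set σ := code s with hσ
  -- The constraints imposed by the neighbourhood of the constant point outside `A`.
  let Q : Set (I → X) := ((S.filter (· ∉ A) : Finset I) : Set I).pi N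
  have hQo : IsOpen Q := isOpen_set_pi (Finset.finite_toSet _) fun a ha =>
    (hN a (Finset.mem_filter.1 (Finset.mem_coe.1 ha)).1).1
  have hQ : ∀ z : I → X, (∀ a ∉ A, z a = p) → z ∈ Q := fun z hz a ha => by
    obtain ⟨h₁, h₂⟩ := Finset.mem_filter.1 (Finset.mem_coe.1 ha)
    rw [hz a h₂]
    exact (hN a h₁).2
  have hsub : finsuppBox b₀ σ ∩ Q ⊆ φ ⁻¹' U := by
    refine fun z hz => hSN fun a ha => ?_
    by_cases haA : a ∈ A
    · have h := hz.1 a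
      rw [hσ, hcode s ⟨a, haA⟩] at h
      have := hs _ h
      simp only [Set.mem_iInter] at this
      exact this ⟨a, haA⟩ (by simpa using ha) rfl
    · exact hz.2 a (by simpa [haA] using ha)
  have hout : ∀ a ∉ A, σ a = 0 := fun a ha => by
    by_contra h
    exact ha (hsupp s (Finsupp.mem_support_iff.2 h))
  constructor
  · obtain ⟨i, hne, hi⟩ := exists_index_image_subset hopen hbne hb (hBo σ) hQo
      ⟨hq σ, hQ _ fun a ha => if_pos (hout a ha)⟩ hsub
    refine ⟨i, fun j => (Set.image_mono (refineOpen_subset _ _)).trans ?_⟩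
    exact (congrArg (φ '' ·) (refineOpen_of_nonempty hne)).trans_subset hi
  · intro i
    obtain ⟨j, hne, hj⟩ := exists_index_image_subset hopen hbne hb (hD₁o σ i) hQo
      ⟨hq₁ σ i, hQ _ fun a ha => hF σ i a fun h => ha (hA σ (hsupp s) i h)⟩
      ((Set.inter_subset_inter_left _ (refineOpen_subset _ _)).trans hsub)
    refine ⟨j, ?_⟩
    exact (congrArg (φ '' ·) (refineOpen_of_nonempty hne)).trans_subset hj

/-! ### Iterated `θ`-closures and cellularity -/

theorem thetaClosure_mono {X : Type*} [TopologicalSpace X] :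
    Monotone (thetaClosure : Set X → Set X) :=
  fun _ _ h _ hx U hU hxU => (hx U hU hxU).mono (Set.inter_subset_inter_right _ h)

theorem subset_thetaClosure {X : Type*} [TopologicalSpace X] (A : Set X) : A ⊆ thetaClosure A :=
  fun x hx _ _ hxU => ⟨x, subset_closure hxU, hx⟩

theorem nThetaClosure_mono {X : Type*} [TopologicalSpace X] (n : ℕ) :
    Monotone (nThetaClosure n : Set X → Set X) :=
  thetaClosure_mono.iterate n

theorem subset_nThetaClosure {X : Type*} [TopologicalSpace X] (n : ℕ) (A : Set X) :
    A ⊆ nThetaClosure n A :=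
  Function.id_le_iterate_of_id_le (fun A => subset_thetaClosure A) n A

theorem nThetaClosure_inter_eq_empty_of_subset {X : Type*} [TopologicalSpace X] {n : ℕ}
    {U V U' V' : Set X} (h : nThetaClosure n U ∩ nThetaClosure n V = ∅) (hU : U' ⊆ U)
    (hV : V' ⊆ V) : nThetaClosure n U' ∩ nThetaClosure n V' = ∅ :=
  Set.subset_eq_empty
    (Set.inter_subset_inter (nThetaClosure_mono n hU) (nThetaClosure_mono n hV)) h

/-- Nonempty sets with pairwise disjoint `n`-`θ`-closures are distinct, so a cellular family may be
indexed by points. -/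
theorem mk_le_thetaUrysohnCellularity_of_family {X : Type u} [TopologicalSpace X] {n : ℕ}
    {C : Set X} {G : X → Set X} (hG : ∀ x ∈ C, IsOpen (G x) ∧ (G x).Nonempty)
    (hC : C.Pairwise fun x y => nThetaClosure n (G x) ∩ nThetaClosure n (G y) = ∅) :
    #C ≤ thetaUrysohnCellularity n X := by
  have hinj : Set.InjOn G C := by
    intro x hx y hy h
    by_contra hne
    obtain ⟨u, hu⟩ := (hG x hx).2
    have : nThetaClosure n (G x) ∩ nThetaClosure n (G y) = ∅ := hC hx hy hne
    rw [← h, Set.inter_self] at this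
    exact this.subset (subset_nThetaClosure n _ hu)
  rw [← mk_image_eq_of_injOn _ _ hinj]
  refine le_ciSup (f := fun 𝒱 : {𝒱 : Set (Set X) // IsThetaUrysohnCellular n 𝒱} => #𝒱.1)
    bddAbove_of_small ⟨G '' C, ?_, ?_⟩
  · rintro _ ⟨x, hx, rfl⟩
    exact (hG x hx).1
  · rintro _ ⟨x, hx, rfl⟩ _ ⟨y, hy, rfl⟩ h
    exact hC hx hy fun hxy => h (hxy ▸ rfl)

theorem one_le_thetaUrysohnCellularity (n : ℕ) (X : Type u) [TopologicalSpace X] :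
    1 ≤ thetaUrysohnCellularity n X := by
  -- The empty set alone is a cellular family.
  refine le_of_eq_of_le (mk_singleton (∅ : Set X)).symm
    (le_ciSup (f := fun 𝒱 : {𝒱 : Set (Set X) // IsThetaUrysohnCellular n 𝒱} => #𝒱.1)
      bddAbove_of_small ⟨{∅}, ?_, ?_⟩)
  · rintro _ rfl
    exact isOpen_empty
  · rintro _ rfl _ rfl h
    exact (h rfl).elim

/-- The cellularity bounds the size of each finite set of points, so it is infinite when the space
is. -/
theorem IsThetaUrysohn.mk_finset_le {X : Type u} [TopologicalSpace X] {n : ℕ}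
    (hn : IsThetaUrysohn n X) (T : Finset X) :
    (T.card : Cardinal.{u}) ≤ thetaUrysohnCellularity n X := by
  classical
  choose! U V hU hV hxU hyV hUV using hn
  have h := mk_le_thetaUrysohnCellularity_of_family (n := n) (C := (T : Set X))
    (G := fun x => ⋂ y ∈ T.erase x, (U x y ∩ V y x)) (fun x _ => ⟨?_, x, ?_⟩) ?_
  · simpa using h
  · exact isOpen_biInter_finset fun y hy =>
      (hU _ _ (Finset.ne_of_mem_erase hy).symm).inter (hV _ _ (Finset.ne_of_mem_erase hy))
  · simp only [Set.mem_iInter]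
    exact fun y hy =>
      ⟨hxU _ _ (Finset.ne_of_mem_erase hy).symm, hyV _ _ (Finset.ne_of_mem_erase hy)⟩
  · intro x hx y hy hxy
    exact nThetaClosure_inter_eq_empty_of_subset (hUV x y hxy)
      ((Set.biInter_subset_of_mem (Finset.mem_coe.2 (Finset.mem_erase.2 ⟨hxy.symm, hy⟩))).trans
        Set.inter_subset_left)
      ((Set.biInter_subset_of_mem (Finset.mem_coe.2 (Finset.mem_erase.2 ⟨hxy, hx⟩))).trans
        Set.inter_subset_right)

/-! ### Local `π`-bases -/

theorem exists_isLocalPiBase_mk_eq {X : Type u} [TopologicalSpace X] (x : X) :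
    ∃ ℬ : Set (Set X), IsLocalPiBase x ℬ ∧ #ℬ = piCharacterAt x :=
  csInf_mem (s := {c | ∃ ℬ : Set (Set X), IsLocalPiBase x ℬ ∧ #ℬ = c})
    ⟨_, {U | IsOpen U ∧ U.Nonempty}, ⟨fun _ h => h, fun U hU hx => ⟨U, ⟨hU, x, hx⟩, subset_rfl⟩⟩,
      rfl⟩

theorem IsLocalPiBase.nonempty {X : Type u} [TopologicalSpace X] {x : X} {ℬ : Set (Set X)}
    (h : IsLocalPiBase x ℬ) : ℬ.Nonempty :=
  let ⟨B, hB, _⟩ := h.2 _ isOpen_univ (Set.mem_univ x)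
  ⟨B, hB⟩

theorem piCharacterAt_le {X : Type u} [TopologicalSpace X] (x : X) :
    piCharacterAt x ≤ piCharacter X :=
  le_ciSup (f := fun x : X => piCharacterAt x) bddAbove_of_small x

theorem one_le_piCharacter (X : Type u) [TopologicalSpace X] [Nonempty X] :
    1 ≤ piCharacter X := by
  obtain ⟨x⟩ := ‹Nonempty X›
  obtain ⟨ℬ, hℬ, h⟩ := exists_isLocalPiBase_mk_eq x
  refine le_trans ?_ (piCharacterAt_le x)
  rw [← h, Cardinal.one_le_iff_ne_zero, mk_ne_zero_iff]
  exact hℬ.nonempty.to_subtype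

theorem exists_indexed_local_piBase {X K : Type u} [TopologicalSpace X]
    (hK : piCharacter X ≤ #K) (x : X) :
    ∃ b : K → Set X, (∀ i, IsOpen (b i)) ∧ (∀ i, (b i).Nonempty) ∧
      ∀ U, IsOpen U → x ∈ U → ∃ i, b i ⊆ U := by
  obtain ⟨ℬ, hℬ, h⟩ := exists_isLocalPiBase_mk_eq x
  have := hℬ.nonempty.to_subtype
  obtain ⟨e⟩ : #ℬ ≤ #K := h.trans_le ((piCharacterAt_le x).trans hK)
  refine ⟨fun k => (Function.invFun e k).1, fun k => (hℬ.1 _ (Function.invFun e k).2).1,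
    fun k => (hℬ.1 _ (Function.invFun e k).2).2, fun U hU hx => ?_⟩
  obtain ⟨B, hB, hBU⟩ := hℬ.2 U hU hx
  obtain ⟨k, hk⟩ := Function.invFun_surjective e.injective ⟨B, hB⟩
  exact ⟨k, (congrArg Subtype.val hk).trans_subset hBU⟩

/-! ### The cardinality bound -/

theorem mk_le_two_power_of_infinite {n : ℕ} {X K : Type u} [TopologicalSpace X] [Infinite K]
    (hX : IsPowerHomogeneous.{u, v} X) (hn : IsThetaUrysohn n X)
    (hc : thetaUrysohnCellularity n X ≤ #K) (hπ : piCharacter X ≤ #K) : #X ≤ 2 ^ #K := by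
  classical
  rcases isEmpty_or_nonempty X with hempty | ⟨⟨p⟩⟩
  · simp
  obtain ⟨I, ⟨a₀⟩, hhom⟩ := hX
  have : Nonempty I := ⟨a₀⟩
  choose b hbo hbne hb using exists_indexed_local_piBase (K := K) hπ
  -- The local `π`-base at `p`, with `0` as the label of the whole space.
  let b₀ : WithZero K → Set X := fun l => Option.elim l Set.univ (b p)
  have hb₀o : ∀ l, IsOpen (b₀ l) := by
    rintro (_ | l)
    exacts [isOpen_univ, hbo p l]
  have hb₀ne : ∀ l, (b₀ l).Nonempty := by
    rintro (_ | l)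
    exacts [⟨p, trivial⟩, hbne p l]
  choose h hh using fun x : X => hhom (fun _ => p) fun _ => x
  choose G hG hGU using fun x : X => exists_labelled_open_sets (K := K)
    (φ := fun z => h x z a₀) ((continuous_apply a₀).comp (h x).continuous)
    ((isOpenMap_eval a₀).comp (h x).isOpenMap) p hbo hbne hb hb₀o hb₀ne rfl
  simp only [hh] at hGU
  obtain ⟨label⟩ : Nonempty (K ≃ (K →₀ WithZero K) × K × K) := by
    have hK := aleph0_le_mk K
    refine Cardinal.eq.1 ?_
    simp [mk_withZero_of_infinite, mul_eq_self hK]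
  let H : K → X → Set X := fun k x => G x (label k).1 (label k).2.1 (label k).2.2
  have hR : ∀ x y, x ≠ y →
      ∃ k, nThetaClosure n (H k x) ∩ nThetaClosure n (H k y) = ∅ := by
    intro x y hxy
    obtain ⟨U, V, hU, hV, hxU, hyV, hUV⟩ := hn x y hxy
    obtain ⟨T₁, W₁, hW₁, hT₁, hs₁⟩ := hGU x U hU hxU
    obtain ⟨T₂, W₂, hW₂, hT₂, hs₂⟩ := hGU y V hV hyV
    have hex : ∀ k, ∃ l : K, b p l ⊆ W₁ k ∩ W₂ k := fun k =>
      hb p _ ((hW₁ k).1.inter (hW₂ k).1) ⟨(hW₁ k).2, (hW₂ k).2⟩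
    choose l hl using hex
    -- A code satisfying the neighbourhood conditions of both points.
    let s : K →₀ WithZero K := Finsupp.onFinset (T₁ ∪ T₂)
      (fun k => if k ∈ T₁ ∪ T₂ then (l k : WithZero K) else 0) fun k hk => by
        by_contra h
        exact hk (if_neg h)
    have hs : ∀ k, b₀ (s k) ⊆ W₁ k ∩ W₂ k := by
      intro k
      by_cases hk : k ∈ T₁ ∪ T₂
      · have : s k = (l k : WithZero K) := if_pos hk
        rw [this]
        exact hl k
      · rw [Finset.mem_union, not_or] at hk
        rw [hT₁ k hk.1, hT₂ k hk.2, Set.inter_self]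
        exact Set.subset_univ _
    -- The first index serves `x` for every second index, which is then free to serve `y`.
    obtain ⟨i, hi⟩ := (hs₁ s fun k => (hs k).trans Set.inter_subset_left).1
    obtain ⟨j, hj⟩ := (hs₂ s fun k => (hs k).trans Set.inter_subset_right).2 i
    refine ⟨label.symm (s, i, j), ?_⟩
    simp only [H, Equiv.apply_symm_apply]
    exact nThetaClosure_inter_eq_empty_of_subset hUV (hi j) hj
  by_contra! hlt
  obtain ⟨k, C, hC, hCK⟩ := exists_large_pairwise_of_two_power_lt
    (fun k x y => nThetaClosure n (H k x) ∩ nThetaClosure n (H k y) = ∅)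
    (fun k x y hxy => by rwa [Set.inter_comm]) hR hlt
  exact hCK.not_ge
    ((mk_le_thetaUrysohnCellularity_of_family (fun x _ => hG x _ _ _) hC).trans hc)

theorem theorem5 (n : ℕ) (X : Type u) [TopologicalSpace X]
    (hX : IsPowerHomogeneous.{u, v} X) (hn : IsThetaUrysohn n X) :
    #X ≤ 2 ^ (thetaUrysohnCellularity n X * piCharacter X) := by
  rcases isEmpty_or_nonempty X with hempty | hne
  · simp
  have hcle := le_mul_of_one_le_right' (a := thetaUrysohnCellularity n X) (one_le_piCharacter X)
  have hπle := le_mul_of_one_le_left' (a := piCharacter X) (one_le_thetaUrysohnCellularity n X)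
  rcases finite_or_infinite X with hfin | hinf
  · have := Fintype.ofFinite X
    rw [mk_fintype]
    exact ((hn.mk_finset_le Finset.univ).trans hcle).trans (cantor _).le
  · have hc : ℵ₀ ≤ thetaUrysohnCellularity n X := aleph0_le.2 fun m => by
      obtain ⟨T, hT⟩ := Infinite.exists_subset_card_eq X m
      exact hT ▸ hn.mk_finset_le T
    have hκ := hc.trans hcle
    obtain ⟨K, hK⟩ : ∃ K : Type u, #K = thetaUrysohnCellularity n X * piCharacter X :=
      ⟨_, mk_out _⟩
    rw [← hK] at hκ hcle hπle ⊢
    have : Infinite K := infinite_iff.2 hκ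
    exact mk_le_two_power_of_infinite.{u, v} hX hn hcle hπle
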